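/- A word $x\in 2^{\mathbb Z}$ is Toeplitz if for every $i\in\mathbb Z$ there is $k\ge 1$ with $x(i+kj)=x(i)$ for all $j\in\mathbb Z$; a Toeplitz subshift is the orbit closure in $2^{\mathbb Z}$ of a Toeplitz word under the shift. Let $(p_n)_{n\in\mathbb N}$ be positive integers with $p_n\mid p_{n+1}$, let $\hat G=\varprojlim \mathbb Z/p_n\mathbb Z$ be the associated odometer, on which $\mathbb Z$ acts by translation, and let $X$ be the space of all Toeplitz subshifts $S\subseteq 2^{\mathbb Z}$ whose maximal equicontinuous factor is $\hat G$, with the Borel structure induced by the Vietoris topology. Let $\Gamma$ be the groupoid with object space $X$ whose arrows $f\colon S\to T$ are all isomorphisms (shift-equivariant homeomorphisms) between elements of $X$. For $S\in X$ and $x\in S$ let $\pi_x\colon S\to\hat G$ be the unique factor map with $\pi_x(x)=0$. Let $\tau\colon X\to 2^{\mathbb Z}$ be any Borel map such that, for every $S\in X$, $\tau(S)$ is a Toeplitz word that belongs to $S$. Define the cocycle $\alpha_0\colon\Gamma\to\hat G$ by $\alpha_0(f)=-\pi_{\tau(T)}\big(f(\tau(S))\big)$ for $f\colon S\to T$, put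 $\Delta=\ker\alpha_0=\{f\in\Gamma:\alpha_0(f)=0\}$, and let $E_\Delta$ be the relation on $X$ given by $S\mathrel{E_\Delta}T$ if and only if there is $f\in\Delta$ with $f\colon S\to T$. Then $E_\Delta$ is a hyperfinite equivalence relation, i.e., it is an equivalence relation that is the union of an increasing sequence of Borel equivalence relations with finite classes. More precisely: 1. $S\mathrel{E_\Delta}T$ if and only if there is an isomorphism $f\colon S\to T$ with $f(\tau(S))=\tau(T)$. 2. For $p\ge 1$ and a permutation $\sigma$ of $2^p$, let $\hat\sigma\colon 2^{\mathbb Z}\to 2^{\mathbb Z}$ be the map that applies $\sigma$ to each block $x|_{[kp,(k+1)p)}$, $k\in\mathbb Z$, and let $S\mathrel{E_p}T$ if and only if $\hat\sigma(\tau(S))=\tau(T)$ for some permutation $\sigma$ of $2^p$. Then every $E_p$ is a Borel equivalence relation on $X$ with finite classes, $E_p\subseteq E_q$ whenever $p\mid q$, and $$E_\Delta=\bigcup_{p} E_p=\bigcup_{n\in\mathbb N}E_{p_n},$$ where the first union is over all periods $p$ of $\hat G$, that is, over all $p\ge 1$ that divide some $p_n$; the last union is increasing. -/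

import Mathlib

open Set Topology CategoryTheory

/-! ### Words and subshifts over `ℤ` -/

/-- Bi-infinite binary words, i.e. the Cantor space `2^ℤ` with the product topology. -/
abbrev Word : Type := ℤ → Bool

/-- The left shift action of `ℤ` on `2^ℤ`: `(n · x)(i) = x(-n + i)`. -/
def shift (n : ℤ) (x : Word) : Word := fun i => x (-n + i)

/-- A word is Toeplitz if every one of its symbols occurs periodically. -/
def IsToeplitzWord (x : Word) : Prop :=
  ∀ i : ℤ, ∃ k : ℤ, 0 < k ∧ ∀ j : ℤ, x (i + k * j) = x i

/-- A subshift: a closed (equivalently compact) shift-invariant subset of `2^ℤ`. -/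
@[ext]
structure Subshift where
  carrier : TopologicalSpace.Compacts Word
  shift_mem : ∀ (n : ℤ) (x : Word), x ∈ carrier → shift n x ∈ carrier

namespace Subshift

/-- The underlying space of a subshift, with the subspace topology. -/
abbrev Pt (S : Subshift) : Type := {x : Word // x ∈ S.carrier}

/-- The dynamical system given by a subshift: `ℤ` acts by the shift. -/
instance (S : Subshift) : AddAction ℤ S.Pt where
  vadd n x := ⟨shift n x.1, S.shift_mem n x.1 x.2⟩
  zero_vadd x := Subtype.ext (funext fun i => by
    change x.1 (-0 + i) = x.1 i
    simp)
  add_vadd m n x := Subtype.ext (funext fun i => by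
    change x.1 (-(m + n) + i) = x.1 (-n + (-m + i))
    rw [neg_add_rev, add_assoc])

/-- The Vietoris topology on the space of subshifts. -/
instance : TopologicalSpace Subshift :=
  TopologicalSpace.induced Subshift.carrier inferInstance

/-- The Borel structure of the Vietoris topology (it is the Effros Borel structure). -/
instance : MeasurableSpace Subshift := borel Subshift

instance : BorelSpace Subshift := ⟨rfl⟩

/-- A subshift is Toeplitz if it is the orbit closure of a Toeplitz word. -/
def IsToeplitz (S : Subshift) : Prop :=
  ∃ x : Word, IsToeplitzWord x ∧
    (S.carrier : Set Word) = closure (Set.range fun n : ℤ => shift n x)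

end Subshift

/-- An isomorphism (topological conjugacy) of subshifts: a shift-equivariant homeomorphism. -/
@[ext]
structure SubshiftIso (S T : Subshift) where
  toHomeo : S.Pt ≃ₜ T.Pt
  map_vadd : ∀ (n : ℤ) (x : S.Pt), toHomeo (n +ᵥ x) = n +ᵥ toHomeo x

namespace SubshiftIso

def refl (S : Subshift) : SubshiftIso S S := ⟨Homeomorph.refl _, fun _ _ => rfl⟩

def symm {S T : Subshift} (f : SubshiftIso S T) : SubshiftIso T S :=
  ⟨f.toHomeo.symm, fun n y => by
    apply f.toHomeo.injective
    rw [f.map_vadd, Homeomorph.apply_symm_apply, Homeomorph.apply_symm_apply]⟩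

def trans {S T U : Subshift} (f : SubshiftIso S T) (g : SubshiftIso T U) : SubshiftIso S U :=
  ⟨f.toHomeo.trans g.toHomeo, fun n x => by
    simp only [Homeomorph.trans_apply, f.map_vadd, g.map_vadd]⟩

end SubshiftIso

/-! ### Maximal equicontinuous factors -/

section Systems

/-- A factor map between topological `ℤ`-systems. -/
structure IsFactorMap {X Y : Type} [TopologicalSpace X] [AddAction ℤ X]
    [TopologicalSpace Y] [AddAction ℤ Y] (f : X → Y) : Prop where
  continuous : Continuous f
  surjective : Function.Surjective f
  map_vadd : ∀ (n : ℤ) (x : X), f (n +ᵥ x) = n +ᵥ f x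

/-- A compact Hausdorff `ℤ`-system is equicontinuous if the maps `z ↦ n · z` are uniformly
equicontinuous with respect to the unique uniformity compatible with the topology. -/
def IsEquicontinuousSystem (Z : Type) [TopologicalSpace Z] [CompactSpace Z] [T2Space Z]
    [AddAction ℤ Z] : Prop :=
  letI : UniformSpace Z := uniformSpaceOfCompactR1
  UniformEquicontinuous fun (n : ℤ) (z : Z) => n +ᵥ z

/-- `π : X → Y` is the maximal equicontinuous factor of `X`: `Y` is an equicontinuous factor of
`X` through which every other equicontinuous factor of `X` factors. -/
structure IsMaxEquicontinuousFactor {X Y : Type} [TopologicalSpace X] [AddAction ℤ X]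
    [TopologicalSpace Y] [CompactSpace Y] [T2Space Y] [AddAction ℤ Y] (π : X → Y) : Prop where
  isFactorMap : IsFactorMap π
  equicontinuous : IsEquicontinuousSystem Y
  universal : ∀ (Z : Type) [TopologicalSpace Z] [CompactSpace Z] [T2Space Z] [AddAction ℤ Z],
    IsEquicontinuousSystem Z → ∀ ρ : X → Z, IsFactorMap ρ →
      ∃ h : Y → Z, IsFactorMap h ∧ ρ = h ∘ π

end Systems

/-! ### Odometers -/

/-- A decreasing sequence `H n = (p n)ℤ` of finite index subgroups of `ℤ`, given by the indices
`p n`, where `p n` divides `p (n + 1)`. -/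
structure PeriodSequence where
  p : ℕ → ℕ
  pos : ∀ n, 0 < p n
  dvd : ∀ n, p n ∣ p (n + 1)

/-- The odometer `lim ℤ / (p n)ℤ`, as a subgroup of the product of the `ℤ / (p n)ℤ`. -/
def odometer (P : PeriodSequence) : AddSubgroup (∀ n, ZMod (P.p n)) where
  carrier := {y | ∀ n, ZMod.castHom (P.dvd n) (ZMod (P.p n)) (y (n + 1)) = y n}
  zero_mem' := fun n => by simp only [Pi.zero_apply, map_zero]
  add_mem' := fun {a b} ha hb n => by
    simp only [Pi.add_apply, map_add, ha n, hb n]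
  neg_mem' := fun {a} ha n => by
    simp only [Pi.neg_apply, map_neg, ha n]

namespace Odometer

variable (P : PeriodSequence)

/-- The canonical homomorphism from `ℤ` to the odometer, with dense image. -/
def ofInt : ℤ →+ odometer P where
  toFun m := ⟨fun _ => (m : ZMod (P.p _)), fun _ => map_intCast _ m⟩
  map_zero' := Subtype.ext (funext fun _ => Int.cast_zero)
  map_add' a b := Subtype.ext (funext fun _ => Int.cast_add a b)

/-- `ℤ` acts on the odometer by translations. -/
instance : AddAction ℤ (odometer P) where
  vadd m y := ofInt P m + y
  zero_vadd y := by
    change ofInt P 0 + y = y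
    rw [map_zero, zero_add]
  add_vadd a b y := by
    change ofInt P (a + b) + y = ofInt P a + (ofInt P b + y)
    rw [map_add, add_assoc]

theorem vadd_def (m : ℤ) (y : odometer P) : m +ᵥ y = ofInt P m + y := rfl

instance : CompactSpace (odometer P) := by
  have : ∀ n, NeZero (P.p n) := fun n => ⟨(P.pos n).ne'⟩
  have : ∀ n, Finite (ZMod (P.p n)) := fun _ => inferInstance
  apply isCompact_iff_compactSpace.mp
  apply IsClosed.isCompact
  change IsClosed {y : ∀ n, ZMod (P.p n) |
    ∀ n, ZMod.castHom (P.dvd n) (ZMod (P.p n)) (y (n + 1)) = y n}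
  rw [Set.ofPred_forall]
  exact isClosed_iInter fun n => isClosed_eq
    ((continuous_of_discreteTopology (f := ZMod.castHom (P.dvd n) (ZMod (P.p n)))).comp
      (continuous_apply (n + 1))) (continuous_apply n)

end Odometer

/-! ### The groupoid of Toeplitz subshifts with a fixed maximal equicontinuous factor -/

/-- The space of Toeplitz subshifts whose maximal equicontinuous factor is the odometer
`lim ℤ / (p n)ℤ`. -/
def ToeplitzSpace (P : PeriodSequence) : Type :=
  {S : Subshift // S.IsToeplitz ∧ ∃ π : S.Pt → odometer P, IsMaxEquicontinuousFactor π}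

namespace ToeplitzSpace

variable {P : PeriodSequence}

instance : MeasurableSpace (ToeplitzSpace P) :=
  inferInstanceAs (MeasurableSpace {S : Subshift //
    S.IsToeplitz ∧ ∃ π : S.Pt → odometer P, IsMaxEquicontinuousFactor π})

/-- The groupoid whose arrows are all isomorphisms between elements of the space. -/
instance : Groupoid (ToeplitzSpace P) where
  Hom S T := SubshiftIso S.1 T.1
  id S := SubshiftIso.refl S.1
  comp f g := SubshiftIso.trans f g
  id_comp _ := rfl
  comp_id _ := rfl
  assoc _ _ _ := rfl
  inv f := SubshiftIso.symm f
  inv_comp f := SubshiftIso.ext (Homeomorph.symm_trans_self f.toHomeo)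
  comp_inv f := SubshiftIso.ext (Homeomorph.self_trans_symm f.toHomeo)

/-- The action of an arrow on points. -/
def app {S T : ToeplitzSpace P} (f : S ⟶ T) (x : S.1.Pt) : T.1.Pt :=
  (show SubshiftIso S.1 T.1 from f).toHomeo x

/-- For every point `x` of `S` there is a unique factor map from `S` to the odometer that maps
`x` to the identity. -/
theorem existsUnique_factorMap (S : ToeplitzSpace P) (x : S.1.Pt) :
    ∃! π : S.1.Pt → odometer P, IsFactorMap π ∧ π x = 0 := by
  obtain ⟨S, ⟨x₀, -, hS⟩, π, ⟨hπ, -, -⟩⟩ := S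
  refine ⟨fun y => π y - π x, ⟨⟨hπ.continuous.sub continuous_const, fun z => ?_,
    fun n y => ?_⟩, sub_self _⟩, ?_⟩
  · obtain ⟨y, hy⟩ := hπ.surjective (z + π x)
    exact ⟨y, by simp [hy]⟩
  · simp only [hπ.map_vadd, Odometer.vadd_def, add_sub_assoc]
  · rintro π' ⟨hπ', h0⟩
    have hx₀ : x₀ ∈ S.carrier := by
      change x₀ ∈ (S.carrier : Set Word)
      rw [hS]
      refine subset_closure ⟨0, funext fun i => ?_⟩
      simp [shift]
    have hd : Dense (Set.range fun n : ℤ => n +ᵥ (⟨x₀, hx₀⟩ : S.Pt)) := by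
      intro y
      rw [closure_subtype, ← Set.range_comp]
      have hy := y.2
      change y.1 ∈ (S.carrier : Set Word) at hy
      rw [hS] at hy
      exact hy
    have hconst : (fun y => π' y - π y) =
        fun _ : S.Pt => π' ⟨x₀, hx₀⟩ - π ⟨x₀, hx₀⟩ := by
      refine Continuous.ext_on hd (hπ'.continuous.sub hπ.continuous) continuous_const ?_
      rintro _ ⟨n, rfl⟩
      simp only [hπ.map_vadd, hπ'.map_vadd, Odometer.vadd_def, add_sub_add_left_eq_sub]
    funext y
    have h1 := congrFun hconst y
    have h2 := congrFun hconst x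
    simp only [h0] at h1 h2
    rw [← h2] at h1
    rw [sub_eq_iff_eq_add.mp h1]
    abel

/-- The unique factor map `π_x` from `S` to the odometer that maps `x` to the identity. -/
noncomputable def factorMap (S : ToeplitzSpace P) (x : S.1.Pt) : S.1.Pt → odometer P :=
  (existsUnique_factorMap S x).choose

end ToeplitzSpace

/-- A Borel map that selects a Toeplitz word in every subshift of the space. -/
structure ToeplitzSelector (P : PeriodSequence) where
  toFun : ToeplitzSpace P → Word
  measurable : Measurable toFun
  mem : ∀ S, toFun S ∈ S.1.carrier
  isToeplitzWord : ∀ S, IsToeplitzWord (toFun S)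

namespace ToeplitzSelector

variable {P : PeriodSequence} (τ : ToeplitzSelector P)

/-- The selected Toeplitz word, as a point of the subshift. -/
def pt (S : ToeplitzSpace P) : S.1.Pt := ⟨τ.toFun S, τ.mem S⟩

/-- The cocycle `α₀(f) = -π_{τ(r(f))}(f(τ(s(f))))`. -/
noncomputable def cocycle {S T : ToeplitzSpace P} (f : S ⟶ T) : odometer P :=
  -(T.factorMap (τ.pt T) (ToeplitzSpace.app f (τ.pt S)))

/-- The kernel `Δ` of the cocycle `α₀`. -/
def kernel (S T : ToeplitzSpace P) : Set (S ⟶ T) := {f | τ.cocycle f = 0}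

/-- The relation `E_Δ` on objects generated by `Δ`. -/
def kernelRel (S T : ToeplitzSpace P) : Prop := ∃ f : S ⟶ T, f ∈ τ.kernel S T

end ToeplitzSelector

/-! ### Block permutations -/

/-- The map `2^ℤ → 2^ℤ` that applies `σ` to each of the blocks `x|[kp, (k+1)p)`, `k ∈ ℤ`. -/
def blockMap {p : ℕ} (hp : 0 < p) (σ : Equiv.Perm (Fin p → Bool)) (x : Word) : Word :=
  fun i => σ (fun j => x (i / (p : ℤ) * (p : ℤ) + ((j : ℕ) : ℤ))) ⟨(i % (p : ℤ)).toNat, by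
    have h1 := Int.emod_nonneg i (show (p : ℤ) ≠ 0 by omega)
    have h2 := Int.emod_lt_of_pos i (show (0 : ℤ) < p by omega)
    omega⟩

/-- The relation `E_p`: some permutation of the blocks of length `p` maps `τ(S)` to `τ(T)`. -/
def ToeplitzSelector.blockRel {P : PeriodSequence} (τ : ToeplitzSelector P) {p : ℕ} (hp : 0 < p)
    (S T : ToeplitzSpace P) : Prop :=
  ∃ σ : Equiv.Perm (Fin p → Bool), blockMap hp σ (τ.toFun S) = τ.toFun T

/-- `p` is a period of the odometer `lim ℤ / (p n)ℤ`: it is positive and divides some `p n`. -/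
def PeriodSequence.IsPeriod (P : PeriodSequence) (p : ℕ) : Prop := 0 < p ∧ ∃ n, p ∣ P.p n

/-! ### Hyperfiniteness -/

/-- A finite Borel equivalence relation. -/
structure IsFiniteBorelEquivalence {X : Type*} [MeasurableSpace X] (F : X → X → Prop) : Prop where
  equivalence : Equivalence F
  measurableSet : MeasurableSet {q : X × X | F q.1 q.2}
  finite : ∀ x, {y | F x y}.Finite

/-- A relation is a hyperfinite equivalence relation if it is an equivalence relation that is the
union of an increasing sequence of finite Borel equivalence relations. -/
def IsHyperfinite {X : Type*} [MeasurableSpace X] (E : X → X → Prop) : Prop :=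
  Equivalence E ∧ ∃ F : ℕ → X → X → Prop,
    (∀ n, IsFiniteBorelEquivalence (F n)) ∧
    (∀ n x y, F n x y → F (n + 1) x y) ∧
    ∀ x y, E x y ↔ ∃ n, F n x y

/-!
Let `x = τ(S)` and `y = τ(T)`.

A Toeplitz subshift is minimal, so the `k`-skeleton of its points is locally constant: it is upper
semicontinuous, and its cardinality is constant. The `k`-skeletons therefore form a finite, hence
equicontinuous, factor, which by maximality is a factor of the odometer. Taking for `k` a period of
a symbol of a Toeplitz word `y` in the subshift, one finds that the symbol has some period `p n`
(`ToeplitzSpace.eventually_period`). It follows that the fibre of `y` over the odometer is a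
singleton (`ToeplitzSpace.eq_of_factorMap_eq_zero`), so the cocycle vanishes at `f : S ⟶ T` if and
only if `f x = y`.

A permutation of the blocks of length `p` that maps `x` to `y` exists if and only if the same pairs
of blocks coincide in `x` and in `y` (`exists_blockMap_eq_iff`). In this form it is plain that `E_p`
is an equivalence relation and grows with `p` in the order of divisibility. It is Borel as a finite
union of preimages of the diagonal under Borel maps. Its classes are finite because `τ` is injective
and there are finitely many permutations.

If an isomorphism `f` maps `x` to `y`, then `f` and its inverse are sliding block codes. For large
`n` the symbols of `x` and `y` in the windows of these codes around the origin have period `p n`,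
so a block of `y` of length `p n` is determined by the corresponding block of `x`, and conversely
(`ToeplitzSelector.eventually_block_eq`). Hence `E_Δ` is contained in the union of the `E_{p n}`.
Conversely, a map `σ̂` that permutes blocks of length `p n` commutes with the shift by `p n`, and
conjugating it by the phase of a point in `ℤ / (p n)ℤ` gives a continuous map that commutes with the
shift and maps `x` to `σ̂ x` (`ToeplitzSelector.exists_continuous_of_blockMap`). Applied to `σ` and
to its inverse, this yields an isomorphism from `S` to `T`.
-/

/-! ### Orbit closures of Toeplitz words -/

@[simp] theorem shift_apply (n : ℤ) (x : Word) (i : ℤ) : shift n x i = x (-n + i) := rfl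

theorem shift_shift (m n : ℤ) (x : Word) : shift m (shift n x) = shift (m + n) x := by
  funext i
  simp only [shift_apply]
  congr 1
  ring

theorem continuous_shift (n : ℤ) : Continuous (shift n) :=
  continuous_pi fun _ => continuous_apply _

/-- The orbit closure of a word under the shift. -/
def orbitClosure (x : Word) : Set Word := closure (Set.range fun n : ℤ => shift n x)

/-- Membership in a closure of a set of words is tested on finite windows. -/
theorem mem_closure_iff_finset {A : Set Word} {x : Word} :
    x ∈ closure A ↔ ∀ F : Finset ℤ, ∃ a ∈ A, ∀ i ∈ F, a i = x i := by
  rw [mem_closure_iff]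
  constructor
  · intro h F
    have ho : IsOpen {a : Word | ∀ i ∈ F, a i = x i} := by
      have : {a : Word | ∀ i ∈ F, a i = x i} = ⋂ i ∈ F, (fun a : Word => a i) ⁻¹' {x i} := by
        ext a
        simp
      rw [this]
      exact isOpen_biInter_finset fun i _ =>
        (isOpen_discrete {x i}).preimage (continuous_apply i)
    obtain ⟨a, ha, haA⟩ := h _ ho fun _ _ => rfl
    exact ⟨a, haA, ha⟩
  · intro h U hU hx
    obtain ⟨F, u, hu, hFU⟩ := isOpen_pi_iff.mp hU x hx
    obtain ⟨a, haA, ha⟩ := h F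
    refine ⟨a, hFU fun i hi => ?_, haA⟩
    rw [ha i hi]
    exact (hu i hi).2

theorem mem_orbitClosure_iff {x z : Word} :
    z ∈ orbitClosure x ↔ ∀ F : Finset ℤ, ∃ n : ℤ, ∀ i ∈ F, x (-n + i) = z i := by
  simp [orbitClosure, mem_closure_iff_finset]

theorem orbitClosure_subset {x z : Word} (h : z ∈ orbitClosure x) :
    orbitClosure z ⊆ orbitClosure x := by
  refine closure_minimal ?_ isClosed_closure
  rintro _ ⟨n, rfl⟩
  refine map_mem_closure (continuous_shift n) h ?_
  rintro _ ⟨m, rfl⟩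
  exact ⟨n + m, (shift_shift n m x).symm⟩

theorem IsToeplitzWord.exists_common_period {x : Word} (hx : IsToeplitzWord x) (F : Finset ℤ) :
    ∃ k : ℤ, 0 < k ∧ ∀ i ∈ F, ∀ j : ℤ, x (i + k * j) = x i := by
  induction F using Finset.induction_on with
  | empty => exact ⟨1, one_pos, by simp⟩
  | insert a F _ ih =>
    obtain ⟨k, hk, h⟩ := ih
    obtain ⟨l, hl, h'⟩ := hx a
    refine ⟨k * l, mul_pos hk hl, fun i hi j => ?_⟩
    rcases Finset.mem_insert.mp hi with rfl | hi
    · rw [mul_comm k l, mul_assoc, h']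
    · rw [mul_assoc, h i hi]

/-- The orbit closure of a Toeplitz word is minimal. -/
theorem IsToeplitzWord.mem_orbitClosure_symm {x w : Word} (hx : IsToeplitzWord x)
    (hw : w ∈ orbitClosure x) : x ∈ orbitClosure w := by
  rw [mem_orbitClosure_iff] at hw ⊢
  intro F
  obtain ⟨k, hk, h⟩ := hx.exists_common_period F
  -- One translate `n` that is good on the whole window `F + [0, k)` can be corrected modulo `k`.
  obtain ⟨n, hn⟩ := hw ((F ×ˢ Finset.Ico 0 k).image fun q => q.1 + q.2)
  refine ⟨-(n % k), fun i hi => ?_⟩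
  have hr : i + n % k ∈ (F ×ˢ Finset.Ico 0 k).image fun q => q.1 + q.2 :=
    Finset.mem_image.mpr ⟨(i, n % k), Finset.mem_product.mpr ⟨hi, Finset.mem_Ico.mpr
      ⟨Int.emod_nonneg _ hk.ne', Int.emod_lt_of_pos _ hk⟩⟩, rfl⟩
  have h1 := hn _ hr
  have h2 := h i hi (-(n / k))
  have h3 := Int.emod_add_mul_ediv n k
  rw [neg_neg, add_comm, ← h1, ← h2]
  congr 1
  linear_combination h3

namespace Subshift

variable {S : Subshift}

instance (S : Subshift) : CompactSpace S.Pt := isCompact_iff_compactSpace.mp S.carrier.isCompact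

@[simp] theorem coe_vadd (n : ℤ) (x : S.Pt) : (n +ᵥ x).1 = shift n x.1 := rfl

theorem continuous_vadd (n : ℤ) : Continuous fun x : S.Pt => n +ᵥ x :=
  ((continuous_shift n).comp continuous_subtype_val).subtype_mk _

/-- A Toeplitz subshift is minimal: it is the orbit closure of each of its points. -/
theorem IsToeplitz.carrier_eq (hS : S.IsToeplitz) (y : S.Pt) :
    (S.carrier : Set Word) = orbitClosure y.1 := by
  obtain ⟨x, hx, h⟩ := hS
  have hy : y.1 ∈ orbitClosure x := by
    have h1 : y.1 ∈ (S.carrier : Set Word) := y.2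
    rwa [h] at h1
  rw [h]
  exact (orbitClosure_subset (hx.mem_orbitClosure_symm hy)).antisymm (orbitClosure_subset hy)

theorem IsToeplitz.mem_orbitClosure (hS : S.IsToeplitz) (y z : S.Pt) :
    z.1 ∈ orbitClosure y.1 := by
  rw [← hS.carrier_eq y]
  exact z.2

theorem IsToeplitz.dense_orbit (hS : S.IsToeplitz) (y : S.Pt) :
    DenseRange fun n : ℤ => n +ᵥ y := by
  intro z
  rw [closure_subtype, ← Set.range_comp]
  exact hS.mem_orbitClosure y z

theorem IsToeplitz.exists_vadd_mem (hS : S.IsToeplitz) (y z : S.Pt) {U : Set S.Pt}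
    (hU : IsOpen U) (hz : z ∈ U) : ∃ n : ℤ, n +ᵥ y ∈ U :=
  (hS.dense_orbit y).exists_mem_open hU ⟨z, hz⟩

end Subshift

/-! ### Skeletons and the periods of Toeplitz words -/

/-- The `k`-skeleton of a word: the pairs `(c, b)` such that the symbol `b` stands at all positions
of the residue class `c` modulo `k`. -/
def skeleton (k : ℕ) (z : Word) : Set (ZMod k × Bool) :=
  {c | ∀ i : ℤ, (i : ZMod k) = c.1 → z i = c.2}

theorem mem_skeleton {k : ℕ} {z : Word} {c : ZMod k × Bool} :
    c ∈ skeleton k z ↔ ∀ i : ℤ, (i : ZMod k) = c.1 → z i = c.2 := Iff.rfl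

theorem mem_skeleton_shift {k : ℕ} {z : Word} {n : ℤ} {c : ZMod k × Bool} :
    c ∈ skeleton k (shift n z) ↔ (c.1 - n, c.2) ∈ skeleton k z := by
  simp only [mem_skeleton, shift_apply]
  constructor
  · intro h i hi
    have := h (n + i) (by push_cast; rw [hi]; ring)
    rwa [neg_add_cancel_left] at this
  · intro h i hi
    exact h _ (by push_cast; rw [hi]; ring)

theorem skeleton_shift {k : ℕ} (n : ℤ) (z : Word) :
    skeleton k (shift n z) = (Equiv.prodCongrLeft fun _ => Equiv.addRight (n : ZMod k)) ''
      skeleton k z := by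
  ext c
  rw [mem_skeleton_shift, Equiv.image_eq_preimage_symm]
  simp [Equiv.prodCongrLeft, sub_eq_add_neg]

theorem ncard_skeleton_shift {k : ℕ} (n : ℤ) (z : Word) :
    (skeleton k (shift n z)).ncard = (skeleton k z).ncard := by
  rw [skeleton_shift, Set.ncard_image_of_injective _ (Equiv.injective _)]

/-- Skeletons are upper semicontinuous. -/
theorem eventually_skeleton_subset (k : ℕ) [NeZero k] (z : Word) :
    ∀ᶠ w in 𝓝 z, skeleton k w ⊆ skeleton k z := by
  have h : ∀ c : ZMod k × Bool, ∀ᶠ w in 𝓝 z, c ∈ skeleton k w → c ∈ skeleton k z := by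
    intro c
    by_cases hc : c ∈ skeleton k z
    · exact Filter.Eventually.of_forall fun _ _ => hc
    · have hc' := hc
      rw [mem_skeleton] at hc'
      push Not at hc'
      obtain ⟨i, hi, hne⟩ := hc'
      have ho : IsOpen ((fun w : Word => w i) ⁻¹' {b | b ≠ c.2}) :=
        (isOpen_discrete _).preimage (continuous_apply i)
      filter_upwards [ho.mem_nhds hne] with w hw hcw
      exact absurd (hcw i hi) hw
  filter_upwards [Filter.eventually_all.mpr h] with w hw c hc using hw c hc

namespace Subshift.IsToeplitz

variable {S : Subshift}

theorem ncard_skeleton_le (hS : S.IsToeplitz) (k : ℕ) [NeZero k] (w z : S.Pt) :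
    (skeleton k w.1).ncard ≤ (skeleton k z.1).ncard := by
  obtain ⟨U, hU, hUo, hzU⟩ := eventually_nhds_iff.mp (eventually_skeleton_subset k z.1)
  obtain ⟨n, hn⟩ := hS.exists_vadd_mem w z (hUo.preimage continuous_subtype_val) hzU
  rw [← ncard_skeleton_shift n w.1]
  exact Set.ncard_le_ncard (hU _ hn) (Set.toFinite _)

/-- On a Toeplitz subshift the skeleton is locally constant: it is upper semicontinuous, and by
minimality its cardinality is constant. -/
theorem isLocallyConstant_skeleton (hS : S.IsToeplitz) (k : ℕ) [NeZero k] :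
    IsLocallyConstant fun z : S.Pt => skeleton k z.1 := by
  rw [IsLocallyConstant.iff_eventually_eq]
  intro z
  have h : ∀ᶠ w : S.Pt in 𝓝 z, skeleton k w.1 ⊆ skeleton k z.1 :=
    continuous_subtype_val.continuousAt.eventually (eventually_skeleton_subset k z.1)
  filter_upwards [h] with w hw
  exact Set.eq_of_subset_of_ncard_le hw (hS.ncard_skeleton_le k z w) (Set.toFinite _)

end Subshift.IsToeplitz

/-- The system of the `k`-skeletons of the points of a subshift. -/
def SkeletonSystem (S : Subshift) (k : ℕ) : Type :=
  Set.range fun z : S.Pt => skeleton k z.1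

namespace SkeletonSystem

variable {S : Subshift} {k : ℕ}

instance : TopologicalSpace (SkeletonSystem S k) := ⊥

instance : DiscreteTopology (SkeletonSystem S k) := ⟨rfl⟩

instance [NeZero k] : Finite (SkeletonSystem S k) :=
  inferInstanceAs (Finite (Set.range fun z : S.Pt => skeleton k z.1))

/-- The skeleton of a point, as a point of the system of skeletons. -/
def mk (k : ℕ) (z : S.Pt) : SkeletonSystem S k := ⟨skeleton k z.1, z, rfl⟩

theorem mk_eq_mk {z w : S.Pt} : mk k z = mk k w ↔ skeleton k z.1 = skeleton k w.1 :=
  Subtype.ext_iff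

theorem mk_surjective : Function.Surjective (mk k : S.Pt → SkeletonSystem S k) := by
  rintro ⟨_, z, rfl⟩
  exact ⟨z, rfl⟩

/-- `ℤ` acts on skeletons by translating the residue classes. -/
instance : AddAction ℤ (SkeletonSystem S k) where
  vadd n A := ⟨{c | (c.1 - n, c.2) ∈ A.1}, by
    obtain ⟨_, z, rfl⟩ := A
    exact ⟨n +ᵥ z, Set.ext fun c => mem_skeleton_shift⟩⟩
  zero_vadd A := Subtype.ext (Set.ext fun c => by
    change (c.1 - ((0 : ℤ) : ZMod k), c.2) ∈ A.1 ↔ c ∈ A.1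
    simp)
  add_vadd m n A := Subtype.ext (Set.ext fun c => by
    change (c.1 - ((m + n : ℤ) : ZMod k), c.2) ∈ A.1 ↔ (c.1 - (m : ZMod k) - n, c.2) ∈ A.1
    rw [Int.cast_add, sub_sub])

theorem mk_vadd (n : ℤ) (z : S.Pt) : mk k (n +ᵥ z) = n +ᵥ mk k z :=
  Subtype.ext (Set.ext fun _ => mem_skeleton_shift)

theorem isFactorMap_mk [NeZero k] (hS : S.IsToeplitz) :
    IsFactorMap (mk k : S.Pt → SkeletonSystem S k) where
  continuous := by
    refine IsLocallyConstant.continuous ?_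
    rw [IsLocallyConstant.iff_eventually_eq]
    intro z
    filter_upwards [(IsLocallyConstant.iff_eventually_eq _).mp (hS.isLocallyConstant_skeleton k) z]
      with w hw
    exact mk_eq_mk.mpr hw
  surjective := mk_surjective
  map_vadd := mk_vadd

end SkeletonSystem

theorem isEquicontinuousSystem_of_discrete (Z : Type) [TopologicalSpace Z] [CompactSpace Z]
    [T2Space Z] [DiscreteTopology Z] [AddAction ℤ Z] : IsEquicontinuousSystem Z := by
  let : UniformSpace Z := uniformSpaceOfCompactR1
  change UniformEquicontinuous fun (n : ℤ) (z : Z) => n +ᵥ z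
  intro V hV
  have hd : Set.diagonal Z ∈ uniformity Z :=
    mem_nhdsSet_iff_forall.mpr fun q hq => (isOpen_discrete (Set.diagonal Z)).mem_nhds hq
  filter_upwards [hd] with q hq n
  have h : q.1 = q.2 := hq
  rw [h]
  exact refl_mem_uniformity hV

theorem PeriodSequence.dvd_of_le (P : PeriodSequence) {m n : ℕ} (h : m ≤ n) : P.p m ∣ P.p n :=
  Nat.le_induction dvd_rfl (fun n _ ih => ih.trans (P.dvd n)) n h

namespace Odometer

variable {P : PeriodSequence}

@[simp] theorem coe_vadd_apply (m : ℤ) (g : odometer P) (n : ℕ) :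
    (m +ᵥ g).1 n = (m : ZMod (P.p n)) + g.1 n := rfl

/-- Integers that are divisible by larger and larger terms of the period sequence tend to zero in
the odometer. -/
theorem tendsto_vadd {m : ℕ → ℤ} (hm : ∀ n, (P.p n : ℤ) ∣ m n) (g : odometer P) :
    Filter.Tendsto (fun n => m n +ᵥ g) Filter.atTop (𝓝 g) := by
  rw [tendsto_subtype_rng, tendsto_pi_nhds]
  intro l
  refine tendsto_const_nhds.congr' ?_
  filter_upwards [Filter.eventually_ge_atTop l] with n hn
  have h : (m n : ZMod (P.p l)) = 0 :=
    (ZMod.intCast_zmod_eq_zero_iff_dvd _ _).mpr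
      ((Int.natCast_dvd_natCast.mpr (P.dvd_of_le hn)).trans (hm n))
  rw [coe_vadd_apply, h, zero_add]

end Odometer

namespace ToeplitzSpace

variable {P : PeriodSequence}

/-- Every symbol of a Toeplitz word in a subshift with maximal equicontinuous factor
`lim ℤ / (p n)ℤ` occurs with some period `p n`. If `k` is any period of the symbol, then the
system of `k`-skeletons is a finite factor of the subshift, hence a factor of the odometer,
and so the `k`-skeleton of the word is fixed by all multiples of some `p n`. -/
theorem eventually_period (S : ToeplitzSpace P) (y : S.1.Pt) (hy : IsToeplitzWord y.1) (i : ℤ) :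
    ∀ᶠ n in Filter.atTop, ∀ m : ℤ, (P.p n : ℤ) ∣ m → y.1 (i + m) = y.1 i := by
  suffices h : ∃ n, ∀ m : ℤ, (P.p n : ℤ) ∣ m → y.1 (i + m) = y.1 i by
    obtain ⟨n, hn⟩ := h
    filter_upwards [Filter.eventually_ge_atTop n] with l hl m hm
    exact hn m ((Int.natCast_dvd_natCast.mpr (P.dvd_of_le hl)).trans hm)
  obtain ⟨k, hk, hky⟩ := hy i
  lift k to ℕ using hk.le
  have : NeZero k := ⟨by rintro rfl; exact lt_irrefl _ hk⟩
  obtain ⟨hS, π, hπ⟩ := S.2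
  obtain ⟨h, hh, hhπ⟩ := hπ.universal (SkeletonSystem S.1 k)
    (isEquicontinuousSystem_of_discrete _) (SkeletonSystem.mk k)
    (SkeletonSystem.isFactorMap_mk hS)
  by_contra! hcon
  choose m hm hne using hcon
  have ht : Filter.Tendsto (fun n => h (-m n +ᵥ π y)) Filter.atTop (𝓝 (h (π y))) :=
    hh.continuous.continuousAt.tendsto.comp
      (Odometer.tendsto_vadd (fun n => (dvd_neg (α := ℤ)).mpr (hm n)) (π y))
  rw [nhds_discrete, Filter.tendsto_pure] at ht
  obtain ⟨n, hn⟩ := ht.exists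
  rw [← hπ.isFactorMap.map_vadd] at hn
  have hn' : SkeletonSystem.mk k (-m n +ᵥ y) = SkeletonSystem.mk k y := by
    rw [hhπ]
    exact hn
  have hi : ((i : ZMod k), y.1 i) ∈ skeleton k y.1 := by
    intro j hj
    obtain ⟨l, hl⟩ := (ZMod.intCast_eq_intCast_iff_dvd_sub _ _ _).mp hj.symm
    change y.1 j = y.1 i
    rw [← hky l, ← hl, add_sub_cancel]
  rw [← SkeletonSystem.mk_eq_mk.mp hn'] at hi
  have := hi i rfl
  rw [Subshift.coe_vadd, shift_apply, neg_neg, add_comm] at this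
  exact hne n this

theorem factorMap_spec (S : ToeplitzSpace P) (x : S.1.Pt) :
    IsFactorMap (S.factorMap x) ∧ S.factorMap x x = 0 :=
  (existsUnique_factorMap S x).choose_spec.1

/-- The fibre of a Toeplitz word over the maximal equicontinuous factor is a singleton. -/
theorem eq_of_factorMap_eq_zero (S : ToeplitzSpace P) {y z : S.1.Pt} (hy : IsToeplitzWord y.1)
    (hz : S.factorMap y z = 0) : z = y := by
  obtain ⟨hπ, hy0⟩ := S.factorMap_spec y
  refine Subtype.ext (funext fun i => ?_)
  obtain ⟨n, hn⟩ := (S.eventually_period y hy i).exists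
  let U : Set S.1.Pt := {w | w.1 i = z.1 i ∧ (S.factorMap y w).1 n = 0}
  have hU : IsOpen U := by
    refine IsOpen.inter ?_ ?_
    · have hc : Continuous fun w : S.1.Pt => w.1 i :=
        (continuous_apply i).comp continuous_subtype_val
      exact (isOpen_discrete {z.1 i}).preimage hc
    · have hc : Continuous fun w : S.1.Pt => (S.factorMap y w).1 n :=
        (continuous_apply n).comp (continuous_subtype_val.comp hπ.continuous)
      exact (isOpen_discrete {0}).preimage hc
  obtain ⟨m, h1, h2⟩ := S.2.1.exists_vadd_mem y z hU ⟨rfl, by rw [hz]; rfl⟩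
  rw [hπ.map_vadd, hy0, Odometer.coe_vadd_apply] at h2
  have h3 : (P.p n : ℤ) ∣ m := (ZMod.intCast_zmod_eq_zero_iff_dvd _ _).mp
    (by simpa using h2)
  rw [← h1, Subshift.coe_vadd, shift_apply, add_comm]
  exact hn _ ((dvd_neg (α := ℤ)).mpr h3)

end ToeplitzSpace

theorem ToeplitzSelector.kernelRel_iff {P : PeriodSequence} (τ : ToeplitzSelector P)
    (S T : ToeplitzSpace P) :
    τ.kernelRel S T ↔ ∃ f : S ⟶ T, ToeplitzSpace.app f (τ.pt S) = τ.pt T := by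
  refine exists_congr fun f => ?_
  change -(T.factorMap (τ.pt T) (ToeplitzSpace.app f (τ.pt S))) = 0 ↔ _
  rw [neg_eq_zero]
  constructor
  · exact T.eq_of_factorMap_eq_zero (τ.isToeplitzWord T)
  · intro h
    rw [h]
    exact (T.factorMap_spec _).2


/-! ### Block permutations -/

/-- The block `x|[kp, (k+1)p)` of a word. -/
def block (p : ℕ) (k : ℤ) (x : Word) : Fin p → Bool := fun j => x (k * p + (j : ℕ))

theorem block_shift (p : ℕ) (k m : ℤ) (x : Word) :
    block p k (shift (m * p) x) = block p (k - m) x := by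
  funext j
  simp only [block, shift_apply]
  congr 1
  ring

theorem eq_of_block_eq {p : ℕ} (hp : 0 < p) {x y : Word} (h : ∀ k, block p k x = block p k y) :
    x = y := by
  funext i
  have h0 : (p : ℤ) ≠ 0 := by omega
  have h1 := Int.emod_nonneg i h0
  have h2 := Int.emod_lt_of_pos i (show (0 : ℤ) < p by omega)
  have h3 := congrFun (h (i / p)) ⟨(i % p).toNat, by omega⟩
  have h4 : i / p * p + ((i % p).toNat : ℤ) = i := by
    rw [Int.toNat_of_nonneg h1]
    exact Int.ediv_mul_add_emod i p
  simpa only [block, h4] using h3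

theorem block_blockMap {p : ℕ} (hp : 0 < p) (σ : Equiv.Perm (Fin p → Bool)) (k : ℤ) (x : Word) :
    block p k (blockMap hp σ x) = σ (block p k x) := by
  funext j
  have hj : ((j : ℕ) : ℤ) < p := by exact_mod_cast j.2
  have h1 : (k * p + ((j : ℕ) : ℤ)) / p = k := by
    rw [add_comm, Int.add_mul_ediv_right _ _ (by omega), Int.ediv_eq_zero_of_lt (by omega) hj,
      zero_add]
  have h2 : ((k * p + ((j : ℕ) : ℤ)) % p).toNat = j := by
    rw [add_comm, Int.add_mul_emod_self_right, Int.emod_eq_of_lt (by omega) hj, Int.toNat_natCast]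
  simp only [block, blockMap, h1, h2]
  rfl

theorem blockMap_shift {p : ℕ} (hp : 0 < p) (σ : Equiv.Perm (Fin p → Bool)) (m : ℤ) (x : Word) :
    blockMap hp σ (shift (m * p) x) = shift (m * p) (blockMap hp σ x) :=
  eq_of_block_eq hp fun k => by simp only [block_blockMap, block_shift]

theorem continuous_blockMap {p : ℕ} (hp : 0 < p) (σ : Equiv.Perm (Fin p → Bool)) :
    Continuous (blockMap hp σ) := by
  refine continuous_pi fun i => ?_
  have h : Continuous fun x : Word =>
      fun j : Fin p => x (i / (p : ℤ) * (p : ℤ) + ((j : ℕ) : ℤ)) :=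
    continuous_pi fun j => continuous_apply _
  exact (continuous_apply _).comp ((continuous_of_discreteTopology (f := σ)).comp h)

theorem blockMap_eq_iff {p : ℕ} (hp : 0 < p) (σ : Equiv.Perm (Fin p → Bool)) (x y : Word) :
    blockMap hp σ x = y ↔ blockMap hp σ.symm y = x := by
  constructor
  · rintro rfl
    exact eq_of_block_eq hp fun k => by simp only [block_blockMap, Equiv.symm_apply_apply]
  · rintro rfl
    exact eq_of_block_eq hp fun k => by simp only [block_blockMap, Equiv.apply_symm_apply]

/-- Two families in a finite type with the same equality pattern differ by a permutation. -/
theorem exists_perm_comp_eq_iff {ι α : Type*} [Finite α] (u v : ι → α) :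
    (∃ σ : Equiv.Perm α, ∀ k, σ (u k) = v k) ↔ ∀ k l, u k = u l ↔ v k = v l := by
  classical
  constructor
  · rintro ⟨σ, h⟩ k l
    rw [← h, ← h, σ.injective.eq_iff]
  · intro h
    let F : {a // a ∈ Set.range u} → {a // a ∈ Set.range v} :=
      fun a => ⟨v a.2.choose, Set.mem_range_self _⟩
    have hF : ∀ k, (F ⟨u k, Set.mem_range_self k⟩).1 = v k := fun k =>
      (h _ k).mp (Set.mem_range_self (f := u) k).choose_spec
    have hb : Function.Bijective F := by
      constructor
      · rintro ⟨_, k, rfl⟩ ⟨_, l, rfl⟩ hkl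
        have h1 := congrArg Subtype.val hkl
        rw [hF, hF] at h1
        exact Subtype.ext ((h k l).mpr h1)
      · rintro ⟨_, k, rfl⟩
        exact ⟨⟨u k, Set.mem_range_self k⟩, Subtype.ext (hF k)⟩
    refine ⟨(Equiv.ofBijective F hb).extendSubtype, fun k => ?_⟩
    rw [Equiv.extendSubtype_apply_of_mem _ _ (Set.mem_range_self k)]
    exact hF k

/-- A word is the image of another one under a permutation of blocks if and only if the same
pairs of blocks coincide in both. -/
theorem exists_blockMap_eq_iff {p : ℕ} (hp : 0 < p) (x y : Word) :
    (∃ σ, blockMap hp σ x = y) ↔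
      ∀ k l, block p k x = block p l x ↔ block p k y = block p l y := by
  rw [← exists_perm_comp_eq_iff]
  refine exists_congr fun σ => ⟨?_, fun h => eq_of_block_eq hp fun k => ?_⟩
  · rintro rfl k
    rw [block_blockMap]
  · rw [block_blockMap, h]

/-- Blocks of length `p * d` coincide if and only if all their sub-blocks of length `p` do. -/
theorem block_mul_eq_iff {p : ℕ} (hp : 0 < p) (d : ℕ) (k l : ℤ) (x : Word) :
    block (p * d) k x = block (p * d) l x ↔
      ∀ a : Fin d, block p (k * d + (a : ℕ)) x = block p (l * d + (a : ℕ)) x := by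
  have key : ∀ (k : ℤ) (a b : ℕ),
      (k * d + a) * p + b = k * ((p * d : ℕ) : ℤ) + ((a * p + b : ℕ) : ℤ) := by
    intro k a b
    push_cast
    ring
  simp only [funext_iff, block]
  constructor
  · intro h a b
    have hlt : (a : ℕ) * p + b < p * d := by
      have h1 : ((a : ℕ) + 1) * p ≤ d * p := Nat.mul_le_mul_right _ a.2
      have h2 := b.2
      nlinarith
    have := h ⟨a * p + b, hlt⟩
    rw [key, key]
    exact this
  · intro h j
    have := h ⟨j / p, Nat.div_lt_of_lt_mul j.2⟩ ⟨j % p, Nat.mod_lt _ hp⟩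
    rw [key, key, Nat.div_add_mod'] at this
    exact this

/-! ### Block codes -/

namespace Subshift

variable {S T : Subshift}

/-- A continuous map commuting with the shift is a sliding block code. -/
theorem exists_window (f : S.Pt → T.Pt) (hf : Continuous f)
    (hv : ∀ (n : ℤ) (x : S.Pt), f (n +ᵥ x) = n +ᵥ f x) :
    ∃ N : ℕ, ∀ (x : S.Pt) (i j : ℤ), (∀ l : ℤ, |l| ≤ N → x.1 (i + l) = x.1 (j + l)) →
      (f x).1 i = (f x).1 j := by
  have hcoord : ∀ i : ℤ, Continuous fun x : S.Pt => x.1 i := fun i =>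
    (continuous_apply i).comp continuous_subtype_val
  have hcoord' : Continuous fun x : S.Pt => (f x).1 0 :=
    (continuous_apply 0).comp (continuous_subtype_val.comp hf)
  -- The pairs that violate the conclusion for a given window are compact and decrease.
  let C : ℕ → Set (S.Pt × S.Pt) := fun N =>
    {q | (∀ l : ℤ, |l| ≤ N → q.1.1 l = q.2.1 l) ∧ (f q.1).1 0 ≠ (f q.2).1 0}
  have hC : ∀ N, IsClosed (C N) := by
    intro N
    have h1 : IsClosed {q : S.Pt × S.Pt | ∀ l : ℤ, |l| ≤ N → q.1.1 l = q.2.1 l} := by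
      have : {q : S.Pt × S.Pt | ∀ l : ℤ, |l| ≤ N → q.1.1 l = q.2.1 l} =
          ⋂ (l : ℤ) (_ : |l| ≤ N), {q | q.1.1 l = q.2.1 l} := by
        ext q
        simp
      rw [this]
      exact isClosed_biInter fun l _ =>
        isClosed_eq ((hcoord l).comp continuous_fst) ((hcoord l).comp continuous_snd)
    have h2 : Continuous fun q : S.Pt × S.Pt => ((f q.1).1 0, (f q.2).1 0) :=
      (hcoord'.comp continuous_fst).prodMk (hcoord'.comp continuous_snd)
    exact h1.inter ((isClosed_discrete {b : Bool × Bool | b.1 ≠ b.2}).preimage h2)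
  obtain ⟨N, hN⟩ : ∃ N, ¬ (C N).Nonempty := by
    by_contra! h
    obtain ⟨q, hq⟩ := IsCompact.nonempty_iInter_of_sequence_nonempty_isCompact_isClosed C
      (fun N q hq => ⟨fun l hl => hq.1 l (hl.trans (by push_cast; omega)), hq.2⟩) h
      (hC 0).isCompact hC
    rw [Set.mem_iInter] at hq
    have : q.1 = q.2 := Subtype.ext (funext fun l =>
      (hq l.natAbs).1 l (by rw [Int.natCast_natAbs]))
    exact (hq 0).2 (by rw [this])
  refine ⟨N, fun x i j h => ?_⟩
  by_contra hne
  refine hN ⟨(-i +ᵥ x, -j +ᵥ x), fun l hl => ?_, ?_⟩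
  · simpa using h l hl
  · simpa only [hv, coe_vadd, shift_apply, neg_neg, add_zero] using hne

end Subshift

/-- Continuous maps that exchange the orbits of points with dense orbits, compatibly with the
shift, come from an isomorphism. -/
theorem SubshiftIso.exists_of_orbits {S T : Subshift} (x : S.Pt) (y : T.Pt)
    (hx : DenseRange fun n : ℤ => n +ᵥ x) (hy : DenseRange fun n : ℤ => n +ᵥ y)
    (f : S.Pt → Word) (hf : Continuous f) (hfx : ∀ n : ℤ, f (n +ᵥ x) = shift n y.1)
    (g : T.Pt → Word) (hg : Continuous g) (hgy : ∀ n : ℤ, g (n +ᵥ y) = shift n x.1) :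
    ∃ F : SubshiftIso S T, F.toHomeo x = y := by
  have hfT : ∀ z, f z ∈ T.carrier := by
    intro z
    have hcl : IsClosed (f ⁻¹' (T.carrier : Set Word)) := T.carrier.isCompact.isClosed.preimage hf
    exact hx.induction_on (p := fun z => f z ∈ (T.carrier : Set Word)) z hcl fun n => by
      rw [hfx]
      exact T.shift_mem n _ y.2
  have hgS : ∀ z, g z ∈ S.carrier := by
    intro z
    have hcl : IsClosed (g ⁻¹' (S.carrier : Set Word)) := S.carrier.isCompact.isClosed.preimage hg
    exact hy.induction_on (p := fun z => g z ∈ (S.carrier : Set Word)) z hcl fun n => by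
      rw [hgy]
      exact S.shift_mem n _ x.2
  let f' : S.Pt → T.Pt := fun z => ⟨f z, hfT z⟩
  let g' : T.Pt → S.Pt := fun z => ⟨g z, hgS z⟩
  have hf' : Continuous f' := hf.subtype_mk _
  have hg' : Continuous g' := hg.subtype_mk _
  have hfx' : ∀ n : ℤ, f' (n +ᵥ x) = n +ᵥ y := fun n => Subtype.ext (hfx n)
  have hgy' : ∀ n : ℤ, g' (n +ᵥ y) = n +ᵥ x := fun n => Subtype.ext (hgy n)
  have hgf : g' ∘ f' = id := hx.equalizer (hg'.comp hf') continuous_id (funext fun n => by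
    simp only [Function.comp_apply, hfx', hgy', id])
  have hfg : f' ∘ g' = id := hy.equalizer (hf'.comp hg') continuous_id (funext fun n => by
    simp only [Function.comp_apply, hfx', hgy', id])
  refine ⟨⟨⟨⟨f', g', congrFun hgf, congrFun hfg⟩, hf', hg'⟩, fun n z => ?_⟩, ?_⟩
  · have h : (fun z => f' (n +ᵥ z)) = fun z => n +ᵥ f' z :=
      hx.equalizer (hf'.comp (Subshift.continuous_vadd n))
        ((Subshift.continuous_vadd n).comp hf') (funext fun m => by
          simp only [Function.comp_apply, ← add_vadd, hfx'])
    exact congrFun h z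
  · change f' x = y
    simpa using hfx' 0

/-! ### The relations `E_p` and the relation `E_Δ` -/

namespace ToeplitzSelector

variable {P : PeriodSequence} (τ : ToeplitzSelector P)

theorem blockRel_iff {p : ℕ} (hp : 0 < p) (S T : ToeplitzSpace P) :
    τ.blockRel hp S T ↔ ∀ k l, block p k (τ.toFun S) = block p l (τ.toFun S) ↔
      block p k (τ.toFun T) = block p l (τ.toFun T) :=
  exists_blockMap_eq_iff hp _ _

theorem blockRel_of_dvd {p q : ℕ} (hp : 0 < p) (hq : 0 < q) (h : p ∣ q) {S T : ToeplitzSpace P}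
    (hST : τ.blockRel hp S T) : τ.blockRel hq S T := by
  obtain ⟨d, rfl⟩ := h
  rw [blockRel_iff] at hST ⊢
  intro k l
  rw [block_mul_eq_iff hp, block_mul_eq_iff hp]
  exact forall_congr' fun a => hST _ _

/-- A Toeplitz subshift is the orbit closure of the word selected in it. -/
theorem toFun_injective : Function.Injective τ.toFun := by
  intro S T h
  refine Subtype.ext (Subshift.ext (TopologicalSpace.Compacts.ext ?_))
  rw [S.2.1.carrier_eq (τ.pt S), T.2.1.carrier_eq (τ.pt T)]
  exact congrArg orbitClosure h

theorem isFiniteBorelEquivalence_blockRel {p : ℕ} (hp : 0 < p) :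
    IsFiniteBorelEquivalence (τ.blockRel hp) where
  equivalence := by
    refine ⟨fun S => ?_, fun {S T} h => ?_, fun {S T U} h h' => ?_⟩
    · exact (τ.blockRel_iff hp S S).mpr fun _ _ => Iff.rfl
    · rw [blockRel_iff] at h ⊢
      exact fun k l => (h k l).symm
    · rw [blockRel_iff] at h h' ⊢
      exact fun k l => (h k l).trans (h' k l)
  measurableSet := by
    have : {q : ToeplitzSpace P × ToeplitzSpace P | τ.blockRel hp q.1 q.2} =
        ⋃ σ : Equiv.Perm (Fin p → Bool), {q | blockMap hp σ (τ.toFun q.1) = τ.toFun q.2} := by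
      ext q
      simp [blockRel]
    rw [this]
    exact MeasurableSet.iUnion fun σ => measurableSet_eq_fun
      ((continuous_blockMap hp σ).measurable.comp (τ.measurable.comp measurable_fst))
      (τ.measurable.comp measurable_snd)
  finite S := by
    refine ((Set.finite_range fun σ : Equiv.Perm (Fin p → Bool) =>
      blockMap hp σ (τ.toFun S)).preimage τ.toFun_injective.injOn).subset ?_
    rintro T ⟨σ, hσ⟩
    exact ⟨σ, hσ⟩

/-- An isomorphism is a sliding block code. If the symbols of `τ(S)` near the origin have period
`p`, then the window of the code at a position of a block of length `p` sees only this block and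
symbols that do not depend on the block; so equal blocks of `τ(S)` go to equal blocks of `τ(T)`. -/
theorem eventually_block_eq {S T : ToeplitzSpace P} (f : S.1.Pt → T.1.Pt) (hf : Continuous f)
    (hv : ∀ (n : ℤ) (x : S.1.Pt), f (n +ᵥ x) = n +ᵥ f x) (hτ : f (τ.pt S) = τ.pt T) :
    ∀ᶠ n in Filter.atTop, ∀ k l, block (P.p n) k (τ.toFun S) = block (P.p n) l (τ.toFun S) →
      block (P.p n) k (τ.toFun T) = block (P.p n) l (τ.toFun T) := by
  obtain ⟨N, hN⟩ := Subshift.exists_window f hf hv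
  have hper : ∀ᶠ n in Filter.atTop, ∀ i ∈ Finset.Icc (-N : ℤ) N, ∀ m : ℤ, (P.p n : ℤ) ∣ m →
      τ.toFun S (i + m) = τ.toFun S i :=
    (Finset.eventually_all _).mpr fun i _ =>
      S.eventually_period (τ.pt S) (τ.isToeplitzWord S) i
  filter_upwards [hper] with n hn k l hkl
  funext j
  have hj : ((j : ℕ) : ℤ) < P.p n := by exact_mod_cast j.2
  have h := hN (τ.pt S) (k * P.p n + (j : ℕ)) (l * P.p n + (j : ℕ)) ?_
  · rwa [hτ] at h
  intro a ha
  obtain ⟨ha1, ha2⟩ := abs_le.mp ha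
  change τ.toFun S _ = τ.toFun S _
  rw [add_assoc, add_assoc]
  rcases lt_or_ge ((j : ℕ) + a : ℤ) 0 with h0 | h0
  · have hi : ((j : ℕ) + a : ℤ) ∈ Finset.Icc (-N : ℤ) N := Finset.mem_Icc.mpr (by omega)
    rw [add_comm (k * _), add_comm (l * _), hn _ hi _ (dvd_mul_left _ _),
      hn _ hi _ (dvd_mul_left _ _)]
  rcases lt_or_ge ((j : ℕ) + a : ℤ) (P.p n) with h1 | h1
  · have := congrFun hkl ⟨((j : ℕ) + a : ℤ).toNat, by omega⟩
    simpa only [block, Int.toNat_of_nonneg h0] using this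
  · have hi : ((j : ℕ) + a - P.p n : ℤ) ∈ Finset.Icc (-N : ℤ) N := Finset.mem_Icc.mpr (by omega)
    have key : ∀ k : ℤ, k * P.p n + ((j : ℕ) + a) = ((j : ℕ) + a - P.p n) + (k + 1) * P.p n :=
      fun k => by ring
    rw [key, key, hn _ hi _ (dvd_mul_left _ _), hn _ hi _ (dvd_mul_left _ _)]

theorem exists_blockRel_of_kernelRel {S T : ToeplitzSpace P} (h : τ.kernelRel S T) :
    ∃ n, τ.blockRel (P.pos n) S T := by
  obtain ⟨f, hf⟩ := (τ.kernelRel_iff S T).mp h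
  let f' : SubshiftIso S.1 T.1 := f
  have hf' : f'.toHomeo (τ.pt S) = τ.pt T := hf
  have h1 := τ.eventually_block_eq f'.toHomeo f'.toHomeo.continuous f'.map_vadd hf'
  have h2 := τ.eventually_block_eq f'.symm.toHomeo f'.symm.toHomeo.continuous f'.symm.map_vadd
    ((f'.toHomeo.symm_apply_eq).mpr hf'.symm)
  obtain ⟨n, hn1, hn2⟩ := (h1.and h2).exists
  exact ⟨n, (τ.blockRel_iff _ S T).mpr fun k l => ⟨hn1 k l, hn2 k l⟩⟩

/-- A permutation of blocks of length `p n` commutes with the shift by `p n`, though in general not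
with the shift by `1`. Conjugating it by the phase of a point, which is the coordinate in
`ℤ / (p n)ℤ` of its image in the odometer, turns it into a map that is continuous and commutes with the shift along the orbit of `τ(S)`. -/
theorem exists_continuous_of_blockMap (S : ToeplitzSpace P) (n : ℕ)
    (σ : Equiv.Perm (Fin (P.p n) → Bool)) :
    ∃ f : S.1.Pt → Word, Continuous f ∧
      ∀ m : ℤ, f (m +ᵥ τ.pt S) = shift m (blockMap (P.pos n) σ (τ.toFun S)) := by
  obtain ⟨hπ, h0⟩ := S.factorMap_spec (τ.pt S)
  have hp0 : NeZero (P.p n) := ⟨(P.pos n).ne'⟩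
  let r : ZMod (P.p n) → ℤ := fun c => c.val
  let φ : S.1.Pt → ZMod (P.p n) := fun z => (S.factorMap (τ.pt S) z).1 n
  have hφ : Continuous φ :=
    (continuous_apply n).comp (continuous_subtype_val.comp hπ.continuous)
  let g : ZMod (P.p n) × S.1.Pt → Word := fun q =>
    shift (r q.1) (blockMap (P.pos n) σ (shift (-r q.1) q.2.1))
  have hg : Continuous g := continuous_prod_of_discrete_left.mpr fun c =>
    (continuous_shift (r c)).comp ((continuous_blockMap (P.pos n) σ).comp
      ((continuous_shift (-r c)).comp continuous_subtype_val))
  refine ⟨fun z => g (φ z, z), hg.comp (hφ.prodMk continuous_id), fun m => ?_⟩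
  have h1 : φ (m +ᵥ τ.pt S) = m := by
    change (S.factorMap (τ.pt S) (m +ᵥ τ.pt S)).1 n = m
    rw [hπ.map_vadd, h0, Odometer.coe_vadd_apply]
    exact add_zero _
  obtain ⟨d, hd⟩ : (P.p n : ℤ) ∣ m - r m := by
    rw [← ZMod.intCast_eq_intCast_iff_dvd_sub]
    simp [r]
  have hd' : -r m + m = d * P.p n := by linear_combination hd
  change shift (r (φ (m +ᵥ τ.pt S))) (blockMap _ σ (shift (-r (φ (m +ᵥ τ.pt S)))
    (shift m (τ.toFun S)))) = _
  rw [h1, shift_shift, hd', blockMap_shift, shift_shift, ← hd', add_neg_cancel_left]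

theorem kernelRel_of_blockRel {S T : ToeplitzSpace P} {n : ℕ} (h : τ.blockRel (P.pos n) S T) :
    τ.kernelRel S T := by
  obtain ⟨σ, hσ⟩ := h
  obtain ⟨f, hf, hfx⟩ := τ.exists_continuous_of_blockMap S n σ
  obtain ⟨g, hg, hgy⟩ := τ.exists_continuous_of_blockMap T n σ.symm
  rw [hσ] at hfx
  rw [(blockMap_eq_iff _ _ _ _).mp hσ] at hgy
  obtain ⟨F, hF⟩ := SubshiftIso.exists_of_orbits (τ.pt S) (τ.pt T) (S.2.1.dense_orbit _)
    (T.2.1.dense_orbit _) f hf hfx g hg hgy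
  exact (τ.kernelRel_iff S T).mpr ⟨F, hF⟩

theorem kernelRel_iff_exists_blockRel (S T : ToeplitzSpace P) :
    τ.kernelRel S T ↔ ∃ n, τ.blockRel (P.pos n) S T :=
  ⟨τ.exists_blockRel_of_kernelRel, fun ⟨_, h⟩ => τ.kernelRel_of_blockRel h⟩

theorem equivalence_kernelRel : Equivalence τ.kernelRel := by
  refine ⟨fun S => ?_, fun {S T} h => ?_, fun {S T U} h h' => ?_⟩
  · exact (τ.kernelRel_iff S S).mpr ⟨𝟙 S, rfl⟩
  · obtain ⟨f, hf⟩ := (τ.kernelRel_iff S T).mp h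
    let f' : SubshiftIso S.1 T.1 := f
    exact (τ.kernelRel_iff T S).mpr ⟨f'.symm, (f'.toHomeo.symm_apply_eq).mpr hf.symm⟩
  · obtain ⟨f, hf⟩ := (τ.kernelRel_iff S T).mp h
    obtain ⟨g, hg⟩ := (τ.kernelRel_iff T U).mp h'
    refine (τ.kernelRel_iff S U).mpr ⟨f ≫ g, ?_⟩
    change ToeplitzSpace.app g (ToeplitzSpace.app f (τ.pt S)) = _
    rw [hf, hg]

end ToeplitzSelector

theorem mainTheorem3 (P : PeriodSequence) (τ : ToeplitzSelector P) :
    IsHyperfinite τ.kernelRel ∧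
    (∀ S T : ToeplitzSpace P, τ.kernelRel S T ↔
      ∃ f : S ⟶ T, ToeplitzSpace.app f (τ.pt S) = τ.pt T) ∧
    (∀ (p : ℕ) (hp : 0 < p), IsFiniteBorelEquivalence (τ.blockRel hp)) ∧
    (∀ (p q : ℕ) (hp : 0 < p) (hq : 0 < q), p ∣ q →
      ∀ S T : ToeplitzSpace P, τ.blockRel hp S T → τ.blockRel hq S T) ∧
    (∀ S T : ToeplitzSpace P, τ.kernelRel S T ↔
      ∃ (p : ℕ) (hp : P.IsPeriod p), τ.blockRel hp.1 S T) ∧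
    (∀ S T : ToeplitzSpace P, τ.kernelRel S T ↔ ∃ n : ℕ, τ.blockRel (P.pos n) S T) := by
  refine ⟨⟨τ.equivalence_kernelRel, fun n => τ.blockRel (P.pos n),
    fun n => τ.isFiniteBorelEquivalence_blockRel (P.pos n),
    fun n S T => τ.blockRel_of_dvd _ _ (P.dvd n), τ.kernelRel_iff_exists_blockRel⟩,
    τ.kernelRel_iff, fun p hp => τ.isFiniteBorelEquivalence_blockRel hp,
    fun p q hp hq h S T => τ.blockRel_of_dvd hp hq h, fun S T => ⟨fun h => ?_, ?_⟩,
    τ.kernelRel_iff_exists_blockRel⟩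
  · obtain ⟨n, hn⟩ := τ.exists_blockRel_of_kernelRel h
    exact ⟨P.p n, ⟨P.pos n, n, dvd_rfl⟩, hn⟩
  · rintro ⟨p, ⟨hp, n, hpn⟩, h⟩
    exact τ.kernelRel_of_blockRel (τ.blockRel_of_dvd hp (P.pos n) hpn h)
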